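/- There is an absolute constant $C>0$ such that the following holds. Let $n\ge 1$ and let $A$ be a subset of the symmetric group $\mathrm{Sym}(n)$ of $\{1,2,\dotsc,n\}$ such that $A=A^{-1}$, $e\in A$, and the subgroup $\langle A\rangle$ generated by $A$ is $\mathrm{Sym}(n)$ or $\mathrm{Alt}(n)$; if $n=2$, assume that $\langle A\rangle=\mathrm{Sym}(2)$. For an integer $k\ge 0$, write $A^k=\{x_1x_2\cdots x_k : x_i\in A\}$ (so $A^0=\{e\}$). Then there are $g\in A^n$, a non-negative integer $\ell\le n^{C\log n}$ and $j,h\in A^{\ell}$ such that the group $\langle g,j,h\rangle$ acts transitively on $\{1,2,\dotsc,n\}$. -/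

import Mathlib

open scoped Pointwise

/-!
The group generated by two independent, nearly uniform permutations `j`, `h` is transitive with
positive probability, and near uniformity is only needed for the action on tuples of logarithmic
length. So `g` can be taken to be the identity: the proof gives the stronger fact that `j` and `h`
alone generate a transitive group.

*Random elements of bounded length.* Put `k = 2 m` with `m` about `log₂ n`. Since the alternating
group is `k`-transitive, any `k`-tuple is moved to any other by a word in `A` whose length is at
most the number `N ≤ n ^ k` of `k`-tuples (`exists_mem_pow_card_smul_eq`). A random walk with
such steps is mixed on `k`-tuples by Doeblin's argument after `O(N ^ 2)` steps, so its law gives each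
event prescribing at most `k` values at most `9 / 8` of its uniform probability
(`exists_weight_perm`).

*A trace argument.* Let `U` be the set of words of length `m` in the two letters `j`, `h`, without
inverses. If a set `S` is invariant under `j` and `h`, then by the Cauchy–Schwarz inequality two random
words of `U` agree on at least one point of `S` on average (`sq_card_le_sum_card_agree`). If the
action is intransitive, `S` and its complement contribute one agreement each. Hence it is enough
that the expected number of points at which two random words agree is less than two
(`eq_univ_of_sum_card_collision_lt`). Equal words contribute `n / |U| ≤ 1 / 4`.

*Collisions of distinct words.* For distinct words `u`, `v` one has to see that `u x = v x` has
probability at most `(1 + o(1)) / n` for uniform `j`, `h`. After cancelling common first and last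
letters, follow both words from `x`, asking for the values of `j` and `h` only when they are needed.
An answer to a new query hits a given point with probability about `1 / n`
(`card_isFresh_hit_mul_le`). If the very last query is new, it must hit the end point of the first
path. Otherwise count in the graph of explored edges: every vertex lies on at least two edge ends,
and the common end point on at least three, so that there are more edges than vertices
(`card_seenPoint_lt_card_query`). Then two of the answers were coincidences, which has probability
`O(m ^ 4 / n ^ 2)` (`card_two_coincidences_mul_le`). Positivity of the words enters here: if the last
query was asked before, a path has reached the end point before its last step, and so leaves it by an
outgoing edge, besides the two incoming edges with which the two paths end.

The collision event is determined by at most `k` values of `j` and `h`, so its probability under the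
law of the walk is at most `(9 / 8) ^ 2` times the uniform one (`sum_prod_weight_le`). Finitely many
small degrees are absorbed in the constant, by means of explicit even permutations.
-/

/-! ### Words of bounded length reach whole orbits -/

/-- Points reachable from `x` by products of `i` elements of `A` form a set that strictly grows with
`i` until it is stable under `A`, hence before `i` exceeds the number of points. -/
theorem exists_mem_pow_card_smul_eq {G X : Type*} [Group G] [MulAction G X] [Fintype X]
    {A : Set G} (hinv : A = A⁻¹) (h1 : (1 : G) ∈ A) {x y : X}
    (hxy : ∃ g ∈ Subgroup.closure A, g • x = y) :
    ∃ g ∈ A ^ Fintype.card X, g • x = y := by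
  classical
  let T : ℕ → Set X := fun i => {z | ∃ g ∈ A ^ i, g • x = z}
  have hsucc : ∀ i, T i ⊆ T (i + 1) := by
    rintro i z ⟨g, hg, rfl⟩
    exact ⟨g, Set.pow_subset_pow_right h1 (Nat.le_succ i) hg, rfl⟩
  have hmono : Monotone T := monotone_nat_of_le_succ hsucc
  have hstab : ∃ i ≤ Fintype.card X, T i = T (i + 1) := by
    by_contra! hne
    have hcard : ∀ i ≤ Fintype.card X + 1, i ≤ (T i).ncard := by
      intro i
      induction i with
      | zero => intro _; exact Nat.zero_le _
      | succ i ih =>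
        intro hi
        have hlt : (T i).ncard < (T (i + 1)).ncard :=
          Set.ncard_lt_ncard ((hsucc i).ssubset_of_ne (hne i (by omega))) (Set.toFinite _)
        have := ih (by omega)
        omega
    have hle : (T (Fintype.card X + 1)).ncard ≤ Fintype.card X := by
      rw [← Nat.card_eq_fintype_card]
      exact Set.ncard_le_card _
    have := hcard _ le_rfl
    omega
  obtain ⟨i, hi, hTi⟩ := hstab
  have hclosed : ∀ g ∈ Subgroup.closure A, ∀ z ∈ T i, g • z ∈ T i := by
    have hA : ∀ a ∈ A, ∀ z ∈ T i, a • z ∈ T i := by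
      rintro a ha z ⟨g, hg, rfl⟩
      rw [hTi]
      exact ⟨a * g, by rw [pow_succ']; exact Set.mul_mem_mul ha hg, mul_smul a g x⟩
    intro g hg
    induction hg using Subgroup.closure_induction'' with
    | mem a ha => exact hA a ha
    | inv_mem a ha => exact hA a⁻¹ (by rw [hinv]; simpa using ha)
    | one => intro z hz; simpa using hz
    | mul a b _ _ iha ihb =>
      intro z hz
      rw [mul_smul]
      exact iha _ (ihb _ hz)
  obtain ⟨g, hg, rfl⟩ := hxy
  have hx : x ∈ T i := hmono (Nat.zero_le i) ⟨1, by simp, one_smul G x⟩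
  exact hmono hi (hclosed g hg x hx)

/-- In a finite group, words of length at most the order of the group exhaust the generated
subgroup. -/
theorem mem_pow_card_of_mem_closure {G : Type*} [Group G] [Fintype G] {A : Set G}
    (hinv : A = A⁻¹) (h1 : (1 : G) ∈ A) {g : G} (hg : g ∈ Subgroup.closure A) :
    g ∈ A ^ Fintype.card G := by
  obtain ⟨a, ha, h⟩ :=
    exists_mem_pow_card_smul_eq (X := G) hinv h1 (x := 1) (y := g) ⟨g, hg, by simp⟩
  simpa [← h] using ha

/-! ### Near-uniform weights from a random walk -/

/-- For a transitive action of a finite group, all transporters `{g | g • x = y}` have the same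
size. -/
theorem card_filter_smul_eq_mul_card {G X : Type*} [Group G] [Fintype G] [MulAction G X]
    [MulAction.IsPretransitive G X] [Fintype X] [DecidableEq X] (x y : X) :
    (Finset.univ.filter fun g : G => g • x = y).card * Fintype.card X = Fintype.card G := by
  have hconst : ∀ z : X, (Finset.univ.filter fun g : G => g • x = z).card =
      (Finset.univ.filter fun g : G => g • x = y).card := by
    intro z
    obtain ⟨a, ha⟩ := MulAction.exists_smul_eq G z y
    refine Finset.card_bij (fun g _ => a * g) ?_ ?_ ?_
    · intro g hg
      simp only [Finset.mem_filter, Finset.mem_univ, true_and] at hg ⊢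
      rw [mul_smul, hg, ha]
    · intro g _ g' _ h
      exact mul_left_cancel h
    · intro g hg
      simp only [Finset.mem_filter, Finset.mem_univ, true_and] at hg
      refine ⟨a⁻¹ * g, ?_, by simp⟩
      simp only [Finset.mem_filter, Finset.mem_univ, true_and]
      rw [mul_smul, hg, ← ha, inv_smul_smul]
  have h := Finset.card_eq_sum_card_fiberwise (s := (Finset.univ : Finset G))
    (t := (Finset.univ : Finset X)) (f := fun g => g • x) (by simp)
  rw [Finset.sum_congr rfl (fun z _ => hconst z)] at h
  simp only [Finset.sum_const, smul_eq_mul, Finset.card_univ] at h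
  rw [h, mul_comm]

/-- If `B x y` moves `x` to `y`, then the walk whose steps are `B x y` for a uniformly random pair
`(x, y)` moves any point to any point with probability at least `1 / |X| ^ 2`; by Doeblin's
argument it gets exponentially close to uniform on `X`. The weight `μ` is the law of the walk
after `t` steps. -/
theorem exists_weight_smul_le {G X : Type*} [Group G] [Fintype G] [DecidableEq G] [MulAction G X]
    [Fintype X] [DecidableEq X] [Nonempty X] {S : Set G} (B : X → X → G)
    (hBS : ∀ x y, B x y ∈ S) (hB : ∀ x y, B x y • x = y) (t : ℕ) :
    ∃ μ : G → ℝ, (∀ g, 0 ≤ μ g) ∧ ∑ g, μ g = 1 ∧ (∀ g, μ g ≠ 0 → g ∈ S ^ t) ∧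
      ∀ x y : X, (∑ g, if g • x = y then μ g else 0) ≤
        1 / (Fintype.card X : ℝ) + (1 - 1 / (Fintype.card X : ℝ)) ^ t := by
  set N : ℝ := (Fintype.card X : ℝ) with hN
  have hN1 : 1 ≤ N := by
    rw [hN]; exact_mod_cast (Nat.one_le_iff_ne_zero.mpr Fintype.card_ne_zero)
  have hN0 : 0 < N := by linarith
  induction t with
  | zero =>
    refine ⟨Pi.single 1 1, ?_, by simp, ?_, ?_⟩
    · intro g
      by_cases h : g = 1 <;> simp [h]
    · intro g hg
      by_cases h : g = 1
      · simp [h]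
      · simp [h] at hg
    · intro x y
      have : (∑ g : G, if g • x = y then (Pi.single 1 1 : G → ℝ) g else 0) ≤
          ∑ g : G, (Pi.single 1 1 : G → ℝ) g := by
        apply Finset.sum_le_sum
        intro g _
        split_ifs
        · exact le_rfl
        · by_cases h : g = 1 <;> simp [h]
      refine this.trans ?_
      have : 0 ≤ 1 / N := by positivity
      simpa using this
  | succ t ih =>
    obtain ⟨μ, h0, h1, hS, hmix⟩ := ih
    refine ⟨fun g => (1 / N ^ 2) * ∑ p : X × X, μ (g * (B p.1 p.2)⁻¹), ?_, ?_, ?_, ?_⟩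
    · intro g
      exact mul_nonneg (by positivity) (Finset.sum_nonneg fun p _ => h0 _)
    · rw [← Finset.mul_sum, Finset.sum_comm]
      have : ∀ p : X × X, ∑ g, μ (g * (B p.1 p.2)⁻¹) = 1 := fun p => by
        rw [← h1]
        exact Equiv.sum_comp (Equiv.mulRight (B p.1 p.2)⁻¹) μ
      simp only [this, Finset.sum_const, Finset.card_univ, Fintype.card_prod, nsmul_eq_mul,
        Nat.cast_mul, mul_one, ← hN]
      field_simp
    · intro g hg
      obtain ⟨p, -, hp⟩ := Finset.exists_ne_zero_of_sum_ne_zero (right_ne_zero_of_mul hg)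
      rw [pow_succ]
      exact ⟨_, hS _ hp, _, hBS p.1 p.2, by simp⟩
    · intro x y
      -- `P z` is the probability that `t` steps lead from `z` to `y`, and `K z / N ^ 2` that a
      -- single step leads from `x` to `z`.
      set P : X → ℝ := fun z => ∑ g, if g • z = y then μ g else 0 with hP
      set K : X → ℝ := fun z => ∑ p : X × X, if B p.1 p.2 • x = z then (1 : ℝ) else 0 with hK
      have hPsum : ∑ z, P z = 1 := by
        rw [hP, Finset.sum_comm, ← h1]
        refine Finset.sum_congr rfl fun g _ => ?_
        rw [Finset.sum_eq_single (g⁻¹ • y)]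
        · simp
        · intro z _ hz
          rw [if_neg]
          rintro rfl
          simp at hz
        · simp
      have hK1 : ∀ z, 1 ≤ K z := by
        intro z
        have : (1 : ℝ) = if B (x, z).1 (x, z).2 • x = z then (1 : ℝ) else 0 := by simp [hB]
        rw [this]
        exact Finset.single_le_sum (f := fun p : X × X => if B p.1 p.2 • x = z then (1 : ℝ) else 0)
          (fun p _ => by positivity) (Finset.mem_univ (x, z))
      have hKsum : ∑ z, K z = N ^ 2 := by
        rw [hK, Finset.sum_comm]
        simp [hN, sq]
      have hstep : (∑ g, if g • x = y then (1 / N ^ 2) * ∑ p : X × X, μ (g * (B p.1 p.2)⁻¹) else 0)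
          = (1 / N ^ 2) * ∑ z, K z * P z := by
        have e1 : ∀ g : G, (if g • x = y then (1 / N ^ 2) * ∑ p : X × X, μ (g * (B p.1 p.2)⁻¹) else 0)
            = (1 / N ^ 2) * ∑ p : X × X, if g • x = y then μ (g * (B p.1 p.2)⁻¹) else 0 := by
          intro g; split_ifs <;> simp
        rw [Finset.sum_congr rfl fun g _ => e1 g, ← Finset.mul_sum, Finset.sum_comm]
        congr 1
        have e2 : ∀ p : X × X, (∑ g, if g • x = y then μ (g * (B p.1 p.2)⁻¹) else 0) =
            P (B p.1 p.2 • x) := by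
          intro p
          rw [hP, ← Equiv.sum_comp (Equiv.mulRight (B p.1 p.2))]
          simp [mul_smul]
        have e3 : ∑ z, K z * P z = ∑ p : X × X, P (B p.1 p.2 • x) := by
          simp only [hK, Finset.sum_mul]
          rw [Finset.sum_comm]
          refine Finset.sum_congr rfl fun p _ => ?_
          simp only [ite_mul, one_mul, zero_mul, Finset.sum_ite_eq, Finset.mem_univ, if_true]
        rw [Finset.sum_congr rfl fun p _ => e2 p, e3]
      rw [hstep]
      have hbound : ∑ z, (K z - 1) * (P z - 1 / N) ≤ ∑ z, (K z - 1) * (1 - 1 / N) ^ t := by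
        refine Finset.sum_le_sum fun z _ => mul_le_mul_of_nonneg_left ?_ (by linarith [hK1 z])
        linarith [hmix z y]
      have hcardsum : ∑ _z : X, (1 : ℝ) = N := by simp [hN]
      have e3 : ∑ z, (K z - 1) * (P z - 1 / N) = ∑ z, K z * P z - N := by
        have : ∀ z, (K z - 1) * (P z - 1 / N) = K z * P z - K z * (1 / N) - P z + 1 * (1 / N) := by
          intro z; ring
        rw [Finset.sum_congr rfl fun z _ => this z, Finset.sum_add_distrib,
          Finset.sum_sub_distrib, Finset.sum_sub_distrib, ← Finset.sum_mul, ← Finset.sum_mul,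
          hKsum, hPsum, hcardsum]
        field_simp
        ring
      have e4 : ∑ z, (K z - 1) * (1 - 1 / N) ^ t = (N ^ 2 - N) * (1 - 1 / N) ^ t := by
        rw [← Finset.sum_mul, Finset.sum_sub_distrib, hKsum, hcardsum]
      rw [e3, e4] at hbound
      have : (1 / N ^ 2) * ∑ z, K z * P z ≤ (1 / N ^ 2) * (N + (N ^ 2 - N) * (1 - 1 / N) ^ t) :=
        mul_le_mul_of_nonneg_left (by linarith) (by positivity)
      refine this.trans (le_of_eq ?_)
      rw [pow_succ (1 - 1 / N) t]
      generalize (1 - 1 / N) ^ t = q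
      field_simp

/-- After `8 |X| ^ 2` steps the walk is uniform on `X` up to the factor `9 / 8`: its expectation of
a nonnegative function of `g • z` is at most `9 / 8` times the average over the group. -/
theorem exists_weight_sum_le {G X : Type*} [Group G] [Fintype G] [DecidableEq G] [MulAction G X]
    [Fintype X] [DecidableEq X] [Nonempty X] {S : Set G}
    (hS : ∀ x y : X, ∃ g ∈ S, g • x = y) :
    ∃ μ : G → ℝ, (∀ g, 0 ≤ μ g) ∧ ∑ g, μ g = 1 ∧
      (∀ g, μ g ≠ 0 → g ∈ S ^ (8 * Fintype.card X ^ 2)) ∧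
      ∀ (z : X) (P : X → Prop) [DecidablePred P], (∑ g, if P (g • z) then μ g else 0) ≤
        9 / 8 * ((Finset.univ.filter fun g : G => P (g • z)).card / Fintype.card G : ℝ) := by
  choose B hBS hB using hS
  have : MulAction.IsPretransitive G X := ⟨fun x y => ⟨B x y, hB x y⟩⟩
  obtain ⟨μ, h0, h1, hsupp, hmix⟩ := exists_weight_smul_le B hBS hB (8 * Fintype.card X ^ 2)
  refine ⟨μ, h0, h1, hsupp, ?_⟩
  intro z P _
  set N : ℝ := (Fintype.card X : ℝ) with hN
  have hN1 : 1 ≤ N := by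
    rw [hN]; exact_mod_cast (Nat.one_le_iff_ne_zero.mpr Fintype.card_ne_zero)
  have hN0 : 0 < N := by linarith
  have hpow : (1 - 1 / N) ^ (8 * Fintype.card X ^ 2) ≤ 1 / (8 * N) := by
    have hbase : 1 - 1 / N ≤ Real.exp (-(1 / N)) := by
      have := Real.add_one_le_exp (-(1 / N)); linarith
    have hbase0 : 0 ≤ 1 - 1 / N := by
      have : 1 / N ≤ 1 := by rw [div_le_one hN0]; exact hN1
      linarith
    calc (1 - 1 / N) ^ (8 * Fintype.card X ^ 2)
        ≤ Real.exp (-(1 / N)) ^ (8 * Fintype.card X ^ 2) := pow_le_pow_left₀ hbase0 hbase _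
      _ = Real.exp (-(8 * N)) := by
          rw [← Real.exp_nat_mul]
          congr 1
          push_cast
          rw [← hN]
          field_simp
      _ = 1 / Real.exp (8 * N) := by rw [Real.exp_neg, one_div]
      _ ≤ 1 / (8 * N) := by
          apply one_div_le_one_div_of_le (by positivity)
          have := Real.add_one_le_exp (8 * N); linarith
  have hle : ∀ y, (∑ g, if g • z = y then μ g else 0) ≤ 9 / 8 * (1 / N) := by
    intro y
    refine (hmix z y).trans ?_
    have : 1 / (8 * N) = 1 / 8 * (1 / N) := by field_simp
    linarith
  have hcard : ∀ y, ((Finset.univ.filter fun g : G => g • z = y).card : ℝ) / Fintype.card G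
      = 1 / N := by
    intro y
    have h := card_filter_smul_eq_mul_card (G := G) z y
    have hG : (0 : ℝ) < Fintype.card G := by exact_mod_cast Fintype.card_pos
    rw [div_eq_div_iff hG.ne' hN0.ne', one_mul]
    rw [hN]
    exact_mod_cast h
  have e1 : (∑ g, if P (g • z) then μ g else 0) =
      ∑ y ∈ Finset.univ.filter P, ∑ g, if g • z = y then μ g else 0 := by
    rw [Finset.sum_comm]
    refine Finset.sum_congr rfl fun g _ => ?_
    rw [Finset.sum_ite_eq]
    simp
  have e2 : ((Finset.univ.filter fun g : G => P (g • z)).card / Fintype.card G : ℝ) =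
      ∑ y ∈ Finset.univ.filter P, 1 / N := by
    rw [← Finset.sum_congr rfl fun y _ => hcard y, ← Finset.sum_div]
    congr 1
    rw [Finset.card_eq_sum_card_fiberwise (f := fun g => g • z) (t := Finset.univ.filter P)
      (by intro g hg; simpa using hg)]
    push_cast
    refine Finset.sum_congr rfl fun y hy => ?_
    congr 2
    ext g
    simp only [Finset.mem_filter, Finset.mem_univ, true_and] at hy ⊢
    constructor
    · exact fun h => h.2
    · rintro rfl; exact ⟨hy, rfl⟩
  rw [e1, e2, Finset.mul_sum]
  exact Finset.sum_le_sum fun y _ => hle y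

/-- If `A` generates at least the alternating group and `k + 2 ≤ n`, some weight supported on words
in `A` of length polynomial in the number of `k`-tuples is uniform up to the factor `9 / 8` on all
events prescribing the images of at most `k` points. -/
theorem exists_weight_perm {n k : ℕ} (hk : k + 2 ≤ n) {A : Set (Equiv.Perm (Fin n))}
    (hinv : A = A⁻¹) (h1 : 1 ∈ A) (hA : alternatingGroup (Fin n) ≤ Subgroup.closure A) :
    ∃ μ : Equiv.Perm (Fin n) → ℝ, (∀ τ, 0 ≤ μ τ) ∧ ∑ τ, μ τ = 1 ∧
      (∀ τ, μ τ ≠ 0 → τ ∈ A ^ (Fintype.card (Fin k ↪ Fin n) *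
        (8 * Fintype.card (Fin k ↪ Fin n) ^ 2))) ∧
      ∀ (D : Finset (Fin n)) (f : Fin n → Fin n), D.card ≤ k →
        (∑ τ ∈ Finset.univ.filter fun τ => ∀ a ∈ D, τ a = f a, μ τ) ≤
          9 / 8 * ((Finset.univ.filter fun τ : Equiv.Perm (Fin n) => ∀ a ∈ D, τ a = f a).card /
            Fintype.card (Equiv.Perm (Fin n)) : ℝ) := by
  classical
  have htrans : MulAction.IsPretransitive (alternatingGroup (Fin n)) (Fin k ↪ Fin n) := by
    have := alternatingGroup.isMultiplyPretransitive (Fin n)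
    exact MulAction.isMultiplyPretransitive_of_le (n := Nat.card (Fin n) - 2)
      (by simp; omega) (by simp)
  have : Nonempty (Fin k ↪ Fin n) := ⟨Fin.castLEEmb (by omega)⟩
  have hS : ∀ x y : Fin k ↪ Fin n, ∃ g ∈ A ^ Fintype.card (Fin k ↪ Fin n), g • x = y := by
    intro x y
    obtain ⟨g, hg⟩ := htrans.exists_smul_eq x y
    exact exists_mem_pow_card_smul_eq hinv h1 ⟨g, hA g.2, hg⟩
  obtain ⟨μ, h0, hsum, hsupp, hmix⟩ := exists_weight_sum_le hS
  refine ⟨μ, h0, hsum, ?_, ?_⟩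
  · intro τ hτ
    rw [pow_mul]
    exact hsupp τ hτ
  · intro D f hD
    obtain ⟨D', hDD', hD'⟩ := Finset.exists_superset_card_eq hD (by simp; omega)
    let Z : Fin k ↪ Fin n := (D'.orderEmbOfFin hD').toEmbedding
    have hZ : ∀ a ∈ D, ∃ i, Z i = a := by
      intro a ha
      have : a ∈ Set.range (D'.orderEmbOfFin hD') := by
        rw [Finset.range_orderEmbOfFin]; exact hDD' ha
      exact this
    have key := hmix Z (fun Y => ∀ a ∈ D, ∀ i, Z i = a → Y i = f a)
    have hiff : ∀ τ : Equiv.Perm (Fin n),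
        (∀ a ∈ D, ∀ i, Z i = a → (τ • Z) i = f a) ↔ ∀ a ∈ D, τ a = f a := by
      intro τ
      constructor
      · intro h a ha
        obtain ⟨i, rfl⟩ := hZ a ha
        exact h _ ha i rfl
      · rintro h _ ha i rfl
        exact h _ ha
    simp only [hiff] at key
    rw [Finset.sum_filter]
    exact key

/-! ### Adaptive exploration of a family of permutations -/

section Exploration

variable {n : ℕ}

/-- A sequence of queries `q σ i = (b, z)` asks for the value `σ b z` of the permutation `σ b` of
the family `σ` at `z`; `queryResult q σ i` is the answer. -/
def queryResult (q : (Bool → Equiv.Perm (Fin n)) → ℕ → Bool × Fin n)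
    (σ : Bool → Equiv.Perm (Fin n)) (i : ℕ) : Fin n :=
  σ (q σ i).1 (q σ i).2

/-- The family `σ'` gives the same answers as `σ` to the first `t` queries of `σ`. -/
def AgreeOnQueries (q : (Bool → Equiv.Perm (Fin n)) → ℕ → Bool × Fin n) (t : ℕ)
    (σ σ' : Bool → Equiv.Perm (Fin n)) : Prop :=
  ∀ i < t, σ' (q σ i).1 (q σ i).2 = queryResult q σ i

/-- A quantity is determined by the queries before time `t` if it takes the same value on families
which agree on these queries. -/
def DeterminedBefore {α : Sort*} (q : (Bool → Equiv.Perm (Fin n)) → ℕ → Bool × Fin n) (t : ℕ)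
    (F : (Bool → Equiv.Perm (Fin n)) → α) : Prop :=
  ∀ σ σ', AgreeOnQueries q t σ σ' → F σ' = F σ

/-- Queries form an exploration if each of them is determined by the answers to the earlier
ones. -/
def IsExploration (q : (Bool → Equiv.Perm (Fin n)) → ℕ → Bool × Fin n) : Prop :=
  ∀ t, DeterminedBefore q t fun σ => q σ t

variable {q : (Bool → Equiv.Perm (Fin n)) → ℕ → Bool × Fin n}

theorem AgreeOnQueries.mono {s t : ℕ} (hst : s ≤ t) {σ σ' : Bool → Equiv.Perm (Fin n)}
    (h : AgreeOnQueries q t σ σ') : AgreeOnQueries q s σ σ' :=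
  fun i hi => h i (hi.trans_le hst)

theorem IsExploration.query_eq (hq : IsExploration q) {t : ℕ} {σ σ' : Bool → Equiv.Perm (Fin n)}
    (h : AgreeOnQueries q t σ σ') {i : ℕ} (hi : i ≤ t) : q σ' i = q σ i :=
  hq i σ σ' (h.mono hi)

theorem IsExploration.determinedBefore_queryResult (hq : IsExploration q) {i t : ℕ} (hi : i < t) :
    DeterminedBefore q t fun σ => queryResult q σ i := by
  intro σ σ' h
  change σ' (q σ' i).1 (q σ' i).2 = _
  rw [hq.query_eq h hi.le]
  exact h i hi

/-- The query at time `t` has not been asked before. -/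
def IsFresh (q : (Bool → Equiv.Perm (Fin n)) → ℕ → Bool × Fin n)
    (σ : Bool → Equiv.Perm (Fin n)) (t : ℕ) : Prop :=
  ∀ i < t, q σ i ≠ q σ t

theorem IsExploration.determinedBefore_isFresh (hq : IsExploration q) (t : ℕ) :
    DeterminedBefore q t fun σ => IsFresh q σ t := by
  intro σ σ' h
  refine propext (forall₂_congr fun i hi => ?_)
  rw [hq.query_eq h hi.le, hq.query_eq h le_rfl]

/-- The answer to a fresh query is at least as random as a choice among `n - t` values: it hits a
target that is known in advance with probability at most `1 / (n - t)`. The proof switches the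
target with any of the values not yet seen, by composing with a transposition. -/
theorem card_isFresh_hit_mul_le (hq : IsExploration q) {t : ℕ}
    {Q : (Bool → Equiv.Perm (Fin n)) → Prop} (hQ : DeterminedBefore q t Q)
    {f : (Bool → Equiv.Perm (Fin n)) → Fin n} (hf : DeterminedBefore q t f)
    [DecidablePred Q] [DecidablePred fun σ => Q σ ∧ IsFresh q σ t ∧ queryResult q σ t = f σ] :
    (Finset.univ.filter fun σ => Q σ ∧ IsFresh q σ t ∧ queryResult q σ t = f σ).card * (n - t) ≤
      (Finset.univ.filter fun σ => Q σ).card := by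
  classical
  set B := Finset.univ.filter fun σ => Q σ ∧ IsFresh q σ t ∧ queryResult q σ t = f σ with hB
  let R : (Bool → Equiv.Perm (Fin n)) → Finset (Fin n) := fun σ =>
    ((Finset.range t).image (queryResult q σ))ᶜ
  have hR : ∀ σ, n - t ≤ (R σ).card := by
    intro σ
    have h : ((Finset.range t).image (queryResult q σ)).card ≤ t := by
      simpa using Finset.card_image_le (s := Finset.range t) (f := queryResult q σ)
    simp only [R, Finset.card_compl, Fintype.card_fin]
    omega
  let switch : (Σ _ : Bool → Equiv.Perm (Fin n), Fin n) → Bool → Equiv.Perm (Fin n) := fun p =>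
    Function.update p.1 (q p.1 t).1 (Equiv.swap (f p.1) p.2 * p.1 (q p.1 t).1)
  have hagree : ∀ p ∈ B.sigma R, AgreeOnQueries q t p.1 (switch p) := by
    rintro ⟨σ, r⟩ hp i hi
    simp only [Finset.mem_sigma, hB, Finset.mem_filter, Finset.mem_univ, true_and, R,
      Finset.mem_compl, Finset.mem_image, Finset.mem_range, not_exists, not_and] at hp
    obtain ⟨⟨-, hfresh, hhit⟩, hr⟩ := hp
    by_cases hb : (q σ i).1 = (q σ t).1
    · have hz : (q σ i).2 ≠ (q σ t).2 := fun hz => hfresh i hi (Prod.ext hb hz)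
      have h2 : queryResult q σ i ≠ r := hr i hi
      unfold queryResult at hhit h2 ⊢
      rw [hb] at h2 ⊢
      have h3 : σ (q σ t).1 (q σ i).2 ≠ f σ := by
        rw [← hhit]
        exact fun h => hz ((σ (q σ t).1).injective h)
      simp only [switch, Function.update_self, Equiv.Perm.coe_mul, Function.comp_apply]
      exact Equiv.swap_apply_of_ne_of_ne h3 h2
    · simp only [switch, Function.update_of_ne hb]
      rfl
  have hres : ∀ p ∈ B.sigma R, switch p (q p.1 t).1 (q p.1 t).2 = p.2 := by
    rintro ⟨σ, r⟩ hp
    simp only [Finset.mem_sigma, hB, Finset.mem_filter, Finset.mem_univ, true_and] at hp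
    have hhit := hp.1.2.2
    unfold queryResult at hhit
    simp only [switch, Function.update_self, Equiv.Perm.coe_mul, Function.comp_apply, hhit,
      Equiv.swap_apply_left]
  have hinj : Set.InjOn switch (B.sigma R : Finset _) := by
    intro p hp p' hp' hpp
    have hq1 : q p.1 t = q p'.1 t := by
      rw [← hq.query_eq (hagree p hp) le_rfl, ← hq.query_eq (hagree p' hp') le_rfl, hpp]
    have hf1 : f p.1 = f p'.1 := by
      rw [← hf _ _ (hagree p hp), ← hf _ _ (hagree p' hp'), hpp]
    have hr : p.2 = p'.2 := by rw [← hres p hp, ← hres p' hp', hq1, hpp]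
    have hσ : p.1 = p'.1 := by
      funext b
      have h := congrFun hpp b
      simp only [switch, hq1, hf1, hr] at h
      by_cases hb : b = (q p'.1 t).1
      · subst hb
        simpa using h
      · simpa [Function.update_of_ne hb] using h
    exact Sigma.ext hσ (heq_of_eq hr)
  calc B.card * (n - t) = ∑ σ ∈ B, (n - t) := by simp
    _ ≤ ∑ σ ∈ B, (R σ).card := Finset.sum_le_sum fun σ _ => hR σ
    _ = (B.sigma R).card := (Finset.card_sigma _ _).symm
    _ ≤ _ := by
      refine Finset.card_le_card_of_injOn switch ?_ hinj
      intro p hp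
      have h := hQ _ _ (hagree p hp)
      have hp' := hp
      simp only [Finset.coe_sigma, Set.mem_sigma_iff, hB, Finset.coe_filter, Finset.mem_univ,
        true_and, Set.mem_ofPred_eq] at hp' ⊢
      rw [h]
      exact hp'.1.1

/-- A weight on permutations that is nearly uniform on events prescribing at most `T` values gives,
for two independent permutations, a weight that is nearly uniform on events determined by the first
`T` queries of an exploration. Such an event is a disjoint union of products of events
prescribing values, one for each possible history. -/
theorem sum_prod_weight_le (hq : IsExploration q) {T : ℕ} {μ : Equiv.Perm (Fin n) → ℝ}
    (hμ0 : ∀ τ, 0 ≤ μ τ)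
    (hμ : ∀ (D : Finset (Fin n)) (f : Fin n → Fin n), D.card ≤ T →
        (∑ τ ∈ Finset.univ.filter fun τ => ∀ a ∈ D, τ a = f a, μ τ) ≤
          9 / 8 * ((Finset.univ.filter fun τ : Equiv.Perm (Fin n) => ∀ a ∈ D, τ a = f a).card /
            Fintype.card (Equiv.Perm (Fin n)) : ℝ))
    {Q : (Bool → Equiv.Perm (Fin n)) → Prop} [DecidablePred Q] (hQ : DeterminedBefore q T Q) :
    (∑ σ ∈ Finset.univ.filter Q, ∏ b, μ (σ b)) ≤
      (9 / 8) ^ 2 * ((Finset.univ.filter Q).card /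
        Fintype.card (Bool → Equiv.Perm (Fin n)) : ℝ) := by
  classical
  let H : (Bool → Equiv.Perm (Fin n)) → Fin T → (Bool × Fin n) × Fin n :=
    fun σ i => (q σ i, queryResult q σ i)
  have hH : ∀ σ σ', H σ' = H σ ↔ AgreeOnQueries q T σ σ' := by
    intro σ σ'
    constructor
    · intro h i hi
      have h' := congrFun h ⟨i, hi⟩
      simp only [H, Prod.mk.injEq] at h'
      rw [← h'.2, ← h'.1]
      rfl
    · intro h
      funext i
      exact Prod.ext (hq.query_eq h i.2.le) (hq.determinedBefore_queryResult i.2 σ σ' h)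
  have hfiber : ∀ σ₀, Q σ₀ →
      (∑ σ ∈ (Finset.univ.filter Q).filter (fun σ => H σ = H σ₀), ∏ b, μ (σ b)) ≤
        (9 / 8) ^ 2 * (((Finset.univ.filter Q).filter (fun σ => H σ = H σ₀)).card /
          Fintype.card (Bool → Equiv.Perm (Fin n)) : ℝ) := by
    intro σ₀ hσ₀
    let D : Bool → Finset (Fin n) := fun b =>
      ((Finset.range T).filter fun i => (q σ₀ i).1 = b).image fun i => (q σ₀ i).2
    let E : Bool → Finset (Equiv.Perm (Fin n)) := fun b =>
      Finset.univ.filter fun τ => ∀ a ∈ D b, τ a = σ₀ b a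
    have hD : ∀ b, (D b).card ≤ T := by
      intro b
      refine Finset.card_image_le.trans ?_
      simpa using Finset.card_filter_le (Finset.range T) fun i => (q σ₀ i).1 = b
    have hpi : (Finset.univ.filter Q).filter (fun σ => H σ = H σ₀) = Fintype.piFinset E := by
      ext σ
      simp only [Finset.mem_filter, Finset.mem_univ, true_and, Fintype.mem_piFinset, E, D,
        Finset.mem_image, Finset.mem_range]
      constructor
      · rintro ⟨-, h⟩ b _ ⟨i, ⟨hi, rfl⟩, rfl⟩
        exact (hH σ₀ σ).1 h i hi
      · intro h
        have hag : AgreeOnQueries q T σ₀ σ := fun i hi => h _ _ ⟨i, ⟨hi, rfl⟩, rfl⟩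
        exact ⟨by rw [hQ _ _ hag]; exact hσ₀, (hH σ₀ σ).2 hag⟩
    rw [hpi, ← Finset.prod_univ_sum, Fintype.card_piFinset]
    calc ∏ b, ∑ τ ∈ E b, μ τ
        ≤ ∏ b, (9 / 8 * ((E b).card / Fintype.card (Equiv.Perm (Fin n)) : ℝ)) :=
          Finset.prod_le_prod (fun b _ => Finset.sum_nonneg fun τ _ => hμ0 τ)
            fun b _ => hμ (D b) (σ₀ b) (hD b)
      _ = _ := by
          rw [Finset.prod_mul_distrib, Finset.prod_div_distrib]
          simp [div_pow]
  rw [← Finset.sum_fiberwise_of_maps_to (s := Finset.univ.filter Q)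
    (t := (Finset.univ.filter Q).image H) (g := H) fun σ hσ => Finset.mem_image_of_mem H hσ,
    Finset.card_eq_sum_card_image H (Finset.univ.filter Q)]
  push_cast
  rw [Finset.sum_div, Finset.mul_sum]
  refine Finset.sum_le_sum fun h hh => ?_
  obtain ⟨σ₀, hσ₀, rfl⟩ := Finset.mem_image.1 hh
  exact hfiber σ₀ (by simpa using hσ₀)

end Exploration

/-! ### Coincidences in an exploration -/

section Coincidence

variable {n : ℕ} {q : (Bool → Equiv.Perm (Fin n)) → ℕ → Bool × Fin n}

/-- The points seen by an exploration: the starting point `x`, then the answers to the queries. -/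
def seenPoint (q : (Bool → Equiv.Perm (Fin n)) → ℕ → Bool × Fin n) (x : Fin n)
    (σ : Bool → Equiv.Perm (Fin n)) : ℕ → Fin n
  | 0 => x
  | i + 1 => queryResult q σ i

/-- At time `t` a fresh query is answered by a point already seen. -/
def IsCoincidence (q : (Bool → Equiv.Perm (Fin n)) → ℕ → Bool × Fin n) (x : Fin n)
    (σ : Bool → Equiv.Perm (Fin n)) (t : ℕ) : Prop :=
  IsFresh q σ t ∧ ∃ s ≤ t, queryResult q σ t = seenPoint q x σ s

theorem IsExploration.determinedBefore_seenPoint (hq : IsExploration q) (x : Fin n) {i t : ℕ}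
    (hi : i ≤ t) : DeterminedBefore q t fun σ => seenPoint q x σ i := by
  cases i with
  | zero => intro σ σ' _; rfl
  | succ i => exact hq.determinedBefore_queryResult hi

open Classical in
/-- Two coincidences among the first `T` queries have probability at most `(T ^ 2 / (n - T)) ^ 2`. -/
theorem card_two_coincidences_mul_le (hq : IsExploration q) (x : Fin n) (T : ℕ) :
    (Finset.univ.filter fun σ => ∃ s t, s < t ∧ t < T ∧ IsCoincidence q x σ s ∧
      IsCoincidence q x σ t).card * (n - T) ^ 2 ≤
        T ^ 4 * Fintype.card (Bool → Equiv.Perm (Fin n)) := by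
  -- A quadruple `(s, s', t, t')` records that times `s < t` hit the points seen at `s'` and `t'`.
  let I : Finset ((ℕ × ℕ) × (ℕ × ℕ)) :=
    ((Finset.range T ×ˢ Finset.range T) ×ˢ (Finset.range T ×ˢ Finset.range T)).filter
      fun p => p.1.1 < p.2.1 ∧ p.1.2 ≤ p.1.1 ∧ p.2.2 ≤ p.2.1
  let hit : ℕ → ℕ → (Bool → Equiv.Perm (Fin n)) → Prop := fun s s' σ =>
    IsFresh q σ s ∧ queryResult q σ s = seenPoint q x σ s'
  let W : (ℕ × ℕ) × (ℕ × ℕ) → Finset (Bool → Equiv.Perm (Fin n)) := fun p =>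
    Finset.univ.filter fun σ => hit p.1.1 p.1.2 σ ∧ hit p.2.1 p.2.2 σ
  have hI : I.card ≤ T ^ 4 := by
    refine (Finset.card_filter_le _ _).trans (le_of_eq ?_)
    simp only [Finset.card_product, Finset.card_range]
    ring
  have hW : ∀ p ∈ I, (W p).card * (n - T) ^ 2 ≤ Fintype.card (Bool → Equiv.Perm (Fin n)) := by
    rintro ⟨⟨s, s'⟩, ⟨t, t'⟩⟩ hp
    simp only [I, Finset.mem_filter, Finset.mem_product, Finset.mem_range] at hp
    obtain ⟨⟨⟨hsT, -⟩, ⟨htT, -⟩⟩, hst, hs', ht'⟩ := hp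
    have hdet : DeterminedBefore q t (hit s s') := by
      intro σ σ' h
      have e1 := hq.determinedBefore_isFresh s σ σ' (h.mono hst.le)
      have e2 := hq.determinedBefore_queryResult hst σ σ' h
      have e3 := hq.determinedBefore_seenPoint x (hs'.trans hst.le) σ σ' h
      simp only [hit] at e1 e2 e3 ⊢
      rw [e1, e2, e3]
    have h1 := card_isFresh_hit_mul_le hq hdet (hq.determinedBefore_seenPoint x ht')
    have h2 := card_isFresh_hit_mul_le hq (t := s) (Q := fun _ => True) (fun _ _ _ => rfl)
      (hq.determinedBefore_seenPoint x hs')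
    simp only [true_and, Finset.filter_true, Finset.card_univ] at h2
    calc (W ((s, s'), (t, t'))).card * (n - T) ^ 2
        ≤ (W ((s, s'), (t, t'))).card * ((n - t) * (n - s)) := by
          rw [sq]
          exact Nat.mul_le_mul_left _ (Nat.mul_le_mul (by omega) (by omega))
      _ = (W ((s, s'), (t, t'))).card * (n - t) * (n - s) := by ring
      _ ≤ _ := (Nat.mul_le_mul_right _ h1).trans h2
  have hsub : (Finset.univ.filter fun σ => ∃ s t, s < t ∧ t < T ∧ IsCoincidence q x σ s ∧
      IsCoincidence q x σ t) ⊆ I.biUnion W := by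
    intro σ hσ
    simp only [Finset.mem_filter, Finset.mem_univ, true_and] at hσ
    obtain ⟨s, t, hst, htT, ⟨hs, s', hs', hs''⟩, ⟨ht, t', ht', ht''⟩⟩ := hσ
    simp only [Finset.mem_biUnion, W, I, hit, Finset.mem_filter, Finset.mem_univ, true_and,
      Finset.mem_product, Finset.mem_range]
    refine ⟨((s, s'), (t, t')), ⟨⟨⟨?_, ?_⟩, ?_, ?_⟩, hst, hs', ht'⟩, ⟨hs, hs''⟩, ht, ht''⟩ <;>
      dsimp only <;> omega
  calc _ ≤ (∑ p ∈ I, (W p).card) * (n - T) ^ 2 :=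
        Nat.mul_le_mul_right _ ((Finset.card_le_card hsub).trans Finset.card_biUnion_le)
    _ = ∑ p ∈ I, (W p).card * (n - T) ^ 2 := Finset.sum_mul _ _ _
    _ ≤ ∑ p ∈ I, Fintype.card (Bool → Equiv.Perm (Fin n)) := Finset.sum_le_sum hW
    _ = I.card * Fintype.card (Bool → Equiv.Perm (Fin n)) := by simp
    _ ≤ _ := Nat.mul_le_mul_right _ hI

/-- The explored graph has the distinct queries as edges and the points seen as vertices. Each fresh
query that is not a coincidence adds one edge and one vertex, so a graph with more edges than
vertices comes with at least two coincidences. -/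
theorem exists_two_coincidences (x : Fin n) (σ : Bool → Equiv.Perm (Fin n)) (T : ℕ)
    (h : ((Finset.range (T + 1)).image (seenPoint q x σ)).card + 1 ≤
      ((Finset.range T).image (q σ)).card) :
    ∃ s t, s < t ∧ t < T ∧ IsCoincidence q x σ s ∧ IsCoincidence q x σ t := by
  classical
  have hfresh : ((Finset.range T).image (q σ)).card ≤
      ((Finset.range T).filter (IsFresh q σ)).card := by
    refine le_trans (Finset.card_le_card (t := ((Finset.range T).filter (IsFresh q σ)).image (q σ))
      ?_) Finset.card_image_le
    intro e he
    have hex : ∃ i, i < T ∧ q σ i = e := by simpa using he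
    simp only [Finset.mem_image, Finset.mem_filter, Finset.mem_range]
    refine ⟨Nat.find hex, ⟨(Nat.find_spec hex).1, fun i hi hqi => ?_⟩, (Nat.find_spec hex).2⟩
    exact Nat.find_min hex hi
      ⟨hi.trans (Nat.find_spec hex).1, hqi.trans (Nat.find_spec hex).2⟩
  set New := (Finset.range T).filter fun t => ∀ s ≤ t, queryResult q σ t ≠ seenPoint q x σ s
    with hNew
  have hnew : New.card + 1 ≤ ((Finset.range (T + 1)).image (seenPoint q x σ)).card := by
    have hx : x ∈ (Finset.range (T + 1)).image (seenPoint q x σ) :=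
      Finset.mem_image.2 ⟨0, by simp, rfl⟩
    rw [← Finset.card_erase_add_one hx]
    refine Nat.add_le_add_right (Finset.card_le_card_of_injOn (queryResult q σ) ?_ ?_) 1
    · intro t ht
      simp only [hNew, Finset.coe_filter, Finset.mem_range, Set.mem_ofPred_eq] at ht
      simp only [Finset.coe_erase, Set.mem_sdiff, Finset.mem_coe, Finset.mem_image,
        Finset.mem_range, Set.mem_singleton_iff]
      exact ⟨⟨t + 1, by omega, rfl⟩, ht.2 0 (Nat.zero_le t)⟩
    · have hne : ∀ s t, s < t → t ∈ New → queryResult q σ t ≠ queryResult q σ s := by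
        intro s t hst ht
        exact (Finset.mem_filter.1 ht).2 (s + 1) hst
      intro s hs t ht hst
      rcases lt_trichotomy s t with hlt | heq | hlt
      · exact absurd hst.symm (hne s t hlt ht)
      · exact heq
      · exact absurd hst (hne t s hlt hs)
  have hcover : (Finset.range T).filter (IsFresh q σ) ⊆
      (Finset.range T).filter (IsCoincidence q x σ) ∪ New := by
    intro t ht
    simp only [Finset.mem_filter, Finset.mem_range, Finset.mem_union, hNew] at ht ⊢
    by_cases hc : ∃ s ≤ t, queryResult q σ t = seenPoint q x σ s
    · exact Or.inl ⟨ht.1, ht.2, hc⟩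
    · push Not at hc
      exact Or.inr ⟨ht.1, hc⟩
  have hle := (Finset.card_le_card hcover).trans (Finset.card_union_le _ _)
  have htwo : 1 < ((Finset.range T).filter (IsCoincidence q x σ)).card := by omega
  obtain ⟨s, hs, t, ht, hst⟩ := Finset.one_lt_card.1 htwo
  simp only [Finset.mem_filter, Finset.mem_range] at hs ht
  rcases lt_or_gt_of_ne hst with hlt | hlt
  · exact ⟨s, t, hlt, ht.1, hs.2, ht.2⟩
  · exact ⟨t, s, hlt, hs.1, ht.2, hs.2⟩

end Coincidence

/-! ### Collisions of two positive words -/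

section Collision

variable {n : ℕ}

/-- The point reached from `x` by applying the first `i` letters of the word `u`, where the letter
`b` acts as the permutation `σ b`. Words are infinite; only prefixes matter. -/
def wordPos (σ : Bool → Equiv.Perm (Fin n)) (u : ℕ → Bool) (x : Fin n) : ℕ → Fin n
  | 0 => x
  | i + 1 => σ (u i) (wordPos σ u x i)

theorem wordPos_succ_eq (σ : Bool → Equiv.Perm (Fin n)) (u : ℕ → Bool) (x : Fin n) (i : ℕ) :
    wordPos σ u x (i + 1) = wordPos σ (fun j => u (j + 1)) (σ (u 0) x) i := by
  induction i with
  | zero => rfl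
  | succ i ih =>
    rw [wordPos, ih]
    rfl

/-- The queries met when the first `m` letters of `u`, and then those of `v`, are applied
to `x`. -/
def collisionQuery (m : ℕ) (u v : ℕ → Bool) (x : Fin n) (σ : Bool → Equiv.Perm (Fin n)) (i : ℕ) :
    Bool × Fin n :=
  if i < m then (u i, wordPos σ u x i) else (v (i - m), wordPos σ v x (i - m))

variable {m : ℕ} {u v : ℕ → Bool} {x : Fin n} {σ : Bool → Equiv.Perm (Fin n)}

theorem collisionQuery_of_lt {i : ℕ} (hi : i < m) :
    collisionQuery m u v x σ i = (u i, wordPos σ u x i) := if_pos hi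

theorem collisionQuery_add (i : ℕ) :
    collisionQuery m u v x σ (m + i) = (v i, wordPos σ v x i) := by
  simp [collisionQuery]

theorem queryResult_collisionQuery_of_lt {i : ℕ} (hi : i < m) :
    queryResult (collisionQuery m u v x) σ i = wordPos σ u x (i + 1) := by
  rw [queryResult, collisionQuery_of_lt hi]
  rfl

theorem queryResult_collisionQuery_add (i : ℕ) :
    queryResult (collisionQuery m u v x) σ (m + i) = wordPos σ v x (i + 1) := by
  rw [queryResult, collisionQuery_add]
  rfl

theorem determinedBefore_wordPos_left (u v : ℕ → Bool) (x : Fin n) {i t : ℕ} (hi : i ≤ m)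
    (ht : i ≤ t) : DeterminedBefore (collisionQuery m u v x) t fun σ => wordPos σ u x i := by
  intro σ σ' h
  change wordPos σ' u x i = wordPos σ u x i
  induction i with
  | zero => rfl
  | succ i ih =>
    have h' := h i (by omega)
    rw [queryResult_collisionQuery_of_lt (by omega), collisionQuery_of_lt (by omega)] at h'
    rw [wordPos, ih (by omega) (by omega)]
    exact h'

theorem determinedBefore_wordPos_right (u v : ℕ → Bool) (x : Fin n) {i t : ℕ}
    (ht : m + i ≤ t) : DeterminedBefore (collisionQuery m u v x) t fun σ => wordPos σ v x i := by
  intro σ σ' h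
  change wordPos σ' v x i = wordPos σ v x i
  induction i with
  | zero => rfl
  | succ i ih =>
    have h' := h (m + i) (by omega)
    rw [queryResult_collisionQuery_add, collisionQuery_add] at h'
    rw [wordPos, ih (by omega)]
    exact h'

theorem isExploration_collisionQuery (m : ℕ) (u v : ℕ → Bool) (x : Fin n) :
    IsExploration (collisionQuery m u v x) := by
  intro t σ σ' h
  change collisionQuery m u v x σ' t = collisionQuery m u v x σ t
  by_cases ht : t < m
  · rw [collisionQuery_of_lt ht, collisionQuery_of_lt ht]
    exact congrArg _ (determinedBefore_wordPos_left u v x ht.le le_rfl σ σ' h)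
  · obtain ⟨i, rfl⟩ := Nat.exists_eq_add_of_le (not_lt.1 ht)
    rw [collisionQuery_add, collisionQuery_add]
    exact congrArg _ (determinedBefore_wordPos_right u v x le_rfl σ σ' h)

/-- Suppose that two words of length `m` with different first letters and different last letters
take `x` to the same point `y`. Every vertex of the explored graph then lies on at least two edge
ends. If the last query is not fresh, then `y` has two incoming edges and an outgoing one, so the
graph has more edges than vertices. -/
theorem card_seenPoint_lt_card_query (hm : 0 < m) (hfirst : u 0 ≠ v 0)
    (hlast : u (m - 1) ≠ v (m - 1)) (hend : wordPos σ u x m = wordPos σ v x m)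
    (hnf : ¬ IsFresh (collisionQuery m u v x) σ (2 * m - 1)) :
    ((Finset.range (2 * m + 1)).image (seenPoint (collisionQuery m u v x) x σ)).card + 1 ≤
      ((Finset.range (2 * m)).image (collisionQuery m u v x σ)).card := by
  set Ed := (Finset.range (2 * m)).image (collisionQuery m u v x σ) with hEd
  set Ve := (Finset.range (2 * m + 1)).image (seenPoint (collisionQuery m u v x) x σ) with hVe
  have hEu : ∀ i < m, (u i, wordPos σ u x i) ∈ Ed := fun i hi =>
    Finset.mem_image.2 ⟨i, by simp; omega, collisionQuery_of_lt hi⟩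
  have hEv : ∀ i < m, (v i, wordPos σ v x i) ∈ Ed := fun i hi =>
    Finset.mem_image.2 ⟨m + i, by simp; omega, collisionQuery_add i⟩
  have hVu : ∀ i ≤ m, wordPos σ u x i ∈ Ve := by
    intro i hi
    refine Finset.mem_image.2 ⟨i, by simp; omega, ?_⟩
    cases i with
    | zero => rfl
    | succ i => exact queryResult_collisionQuery_of_lt (by omega)
  have hVv : ∀ i ≤ m, wordPos σ v x i ∈ Ve := by
    intro i hi
    cases i with
    | zero => exact hVu 0 (Nat.zero_le m)
    | succ i =>
      exact Finset.mem_image.2 ⟨m + i + 1, by simp; omega, queryResult_collisionQuery_add i⟩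
  have hVe' : ∀ z ∈ Ve, ∃ i ≤ m, z = wordPos σ u x i ∨ z = wordPos σ v x i := by
    intro z hz
    obtain ⟨i, hi, rfl⟩ := Finset.mem_image.1 hz
    rw [Finset.mem_range] at hi
    cases i with
    | zero => exact ⟨0, Nat.zero_le m, Or.inl rfl⟩
    | succ i =>
      by_cases him : i < m
      · exact ⟨i + 1, him, Or.inl (queryResult_collisionQuery_of_lt him)⟩
      · obtain ⟨k, rfl⟩ := Nat.exists_eq_add_of_le (not_lt.1 him)
        exact ⟨k + 1, by omega, Or.inr (queryResult_collisionQuery_add k)⟩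
  let out : Fin n → Finset (Bool × Fin n) := fun z => Ed.filter fun e => e.2 = z
  let inc : Fin n → Finset (Bool × Fin n) := fun z => Ed.filter fun e => σ e.1 e.2 = z
  have hout_u : ∀ i < m, (u i, wordPos σ u x i) ∈ out (wordPos σ u x i) := fun i hi =>
    Finset.mem_filter.2 ⟨hEu i hi, rfl⟩
  have hout_v : ∀ i < m, (v i, wordPos σ v x i) ∈ out (wordPos σ v x i) := fun i hi =>
    Finset.mem_filter.2 ⟨hEv i hi, rfl⟩
  have hinc_u : ∀ i < m, (u i, wordPos σ u x i) ∈ inc (wordPos σ u x (i + 1)) := fun i hi =>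
    Finset.mem_filter.2 ⟨hEu i hi, rfl⟩
  have hinc_v : ∀ i < m, (v i, wordPos σ v x i) ∈ inc (wordPos σ v x (i + 1)) := fun i hi =>
    Finset.mem_filter.2 ⟨hEv i hi, rfl⟩
  have hsum_out : Ed.card = ∑ z ∈ Ve, (out z).card := by
    refine Finset.card_eq_sum_card_fiberwise fun e he => ?_
    obtain ⟨i, hi, rfl⟩ := Finset.mem_image.1 he
    rw [Finset.mem_range] at hi
    by_cases him : i < m
    · rw [collisionQuery_of_lt him]; exact hVu i him.le
    · obtain ⟨k, rfl⟩ := Nat.exists_eq_add_of_le (not_lt.1 him)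
      rw [collisionQuery_add]; exact hVv k (by omega)
  have hsum_inc : Ed.card = ∑ z ∈ Ve, (inc z).card := by
    refine Finset.card_eq_sum_card_fiberwise fun e he => ?_
    obtain ⟨i, hi, rfl⟩ := Finset.mem_image.1 he
    rw [Finset.mem_range] at hi
    by_cases him : i < m
    · rw [collisionQuery_of_lt him]; exact hVu (i + 1) him
    · obtain ⟨k, rfl⟩ := Nat.exists_eq_add_of_le (not_lt.1 him)
      rw [collisionQuery_add]; exact hVv (k + 1) (by omega)
  have hstart : 1 < (out x).card :=
    Finset.one_lt_card.2 ⟨_, hout_u 0 hm, _, hout_v 0 hm, fun h => hfirst (congrArg Prod.fst h)⟩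
  have hfinish : 1 < (inc (wordPos σ u x m)).card := by
    have h1 := hinc_u (m - 1) (by omega)
    have h2 := hinc_v (m - 1) (by omega)
    rw [Nat.sub_add_cancel hm] at h1 h2
    rw [← hend] at h2
    exact Finset.one_lt_card.2 ⟨_, h1, _, h2, fun h => hlast (congrArg Prod.fst h)⟩
  have hdeg : ∀ z ∈ Ve, 2 ≤ (out z).card + (inc z).card := by
    intro z hz
    obtain ⟨i, him, hzi⟩ := hVe' z hz
    rcases Nat.eq_zero_or_pos i with rfl | hi0
    · have : z = x := by rcases hzi with h | h <;> exact h
      rw [this]; omega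
    · rcases him.lt_or_eq with hlt | rfl
      · rcases hzi with rfl | rfl
        · have h1 := Finset.card_pos.2 ⟨_, hout_u i hlt⟩
          have h2 := hinc_u (i - 1) (by omega)
          rw [Nat.sub_add_cancel hi0] at h2
          have h2 := Finset.card_pos.2 ⟨_, h2⟩
          omega
        · have h1 := Finset.card_pos.2 ⟨_, hout_v i hlt⟩
          have h2 := hinc_v (i - 1) (by omega)
          rw [Nat.sub_add_cancel hi0] at h2
          have h2 := Finset.card_pos.2 ⟨_, h2⟩
          omega
      · have : z = wordPos σ u x i := by
          rcases hzi with h | h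
          · exact h
          · rw [h, hend]
        rw [this]; omega
  have hout_end : 0 < (out (wordPos σ u x m)).card := by
    simp only [IsFresh, not_forall, not_not] at hnf
    obtain ⟨i, hi, hqi⟩ := hnf
    have hidx : 2 * m - 1 = m + (m - 1) := by omega
    rw [hidx, collisionQuery_add] at hqi
    have hvm : σ (v (m - 1)) (wordPos σ v x (m - 1)) = wordPos σ u x m := by
      rw [hend]
      conv_rhs => rw [← Nat.sub_add_cancel hm]
      rfl
    by_cases him : i < m
    · rw [collisionQuery_of_lt him, Prod.mk.injEq] at hqi
      have hne : i ≠ m - 1 := by rintro rfl; exact hlast hqi.1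
      have h := hout_u (i + 1) (by omega)
      rw [wordPos, hqi.1, hqi.2, hvm] at h
      exact Finset.card_pos.2 ⟨_, h⟩
    · obtain ⟨k, rfl⟩ := Nat.exists_eq_add_of_le (not_lt.1 him)
      rw [collisionQuery_add, Prod.mk.injEq] at hqi
      have h := hout_v (k + 1) (by omega)
      rw [wordPos, hqi.1, hqi.2, hvm] at h
      exact Finset.card_pos.2 ⟨_, h⟩
  have hstrict : ∑ _z ∈ Ve, 2 < ∑ z ∈ Ve, ((out z).card + (inc z).card) :=
    Finset.sum_lt_sum hdeg ⟨_, hVu m le_rfl, by omega⟩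
  rw [Finset.sum_add_distrib, ← hsum_out, ← hsum_inc, Finset.sum_const, smul_eq_mul] at hstrict
  omega

/-- Either the last query is fresh and hits the end point of the first word, or there are two
coincidences. -/
theorem card_collision_mul_le_of_ne {M : ℕ} (hm : 0 < m) (hmM : m ≤ M) (hfirst : u 0 ≠ v 0)
    (hlast : u (m - 1) ≠ v (m - 1)) (x : Fin n) :
    (Finset.univ.filter fun σ : Bool → Equiv.Perm (Fin n) =>
      wordPos σ u x m = wordPos σ v x m).card * (n - 2 * M) ^ 2 ≤
        ((n - 2 * M) + (2 * M) ^ 4) * Fintype.card (Bool → Equiv.Perm (Fin n)) := by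
  classical
  set q := collisionQuery m u v x with hqdef
  have hq : IsExploration q := isExploration_collisionQuery m u v x
  set E1 := Finset.univ.filter fun σ : Bool → Equiv.Perm (Fin n) =>
    True ∧ IsFresh q σ (2 * m - 1) ∧ queryResult q σ (2 * m - 1) = wordPos σ u x m
  set E2 := Finset.univ.filter fun σ : Bool → Equiv.Perm (Fin n) =>
    ∃ s t, s < t ∧ t < 2 * m ∧ IsCoincidence q x σ s ∧ IsCoincidence q x σ t
  have h1 : E1.card * (n - (2 * m - 1)) ≤ Fintype.card (Bool → Equiv.Perm (Fin n)) := by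
    have := card_isFresh_hit_mul_le hq (t := 2 * m - 1) (Q := fun _ => True) (fun _ _ _ => rfl)
      (determinedBefore_wordPos_left u v x le_rfl (by omega))
    simpa [E1] using this
  have h2 : E2.card * (n - 2 * m) ^ 2 ≤
      (2 * m) ^ 4 * Fintype.card (Bool → Equiv.Perm (Fin n)) :=
    card_two_coincidences_mul_le hq x (2 * m)
  have hsub : (Finset.univ.filter fun σ : Bool → Equiv.Perm (Fin n) =>
      wordPos σ u x m = wordPos σ v x m) ⊆ E1 ∪ E2 := by
    intro σ hσ
    simp only [Finset.mem_filter, Finset.mem_univ, true_and] at hσ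
    simp only [Finset.mem_union, E1, E2, Finset.mem_filter, Finset.mem_univ, true_and]
    by_cases hf : IsFresh q σ (2 * m - 1)
    · refine Or.inl ⟨hf, ?_⟩
      have hidx : 2 * m - 1 = m + (m - 1) := by omega
      rw [hidx, hqdef, queryResult_collisionQuery_add, Nat.sub_add_cancel hm, hσ]
    · exact Or.inr (exists_two_coincidences x σ (2 * m)
        (card_seenPoint_lt_card_query hm hfirst hlast hσ hf))
  have h1' : E1.card * (n - 2 * M) ≤ Fintype.card (Bool → Equiv.Perm (Fin n)) :=
    (Nat.mul_le_mul_left _ (by omega)).trans h1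
  have h2' : E2.card * (n - 2 * M) ^ 2 ≤
      (2 * M) ^ 4 * Fintype.card (Bool → Equiv.Perm (Fin n)) :=
    ((Nat.mul_le_mul_left _ (Nat.pow_le_pow_left (by omega) 2)).trans h2).trans
      (Nat.mul_le_mul_right _ (Nat.pow_le_pow_left (by omega) 4))
  calc _ ≤ (E1.card + E2.card) * (n - 2 * M) ^ 2 :=
        Nat.mul_le_mul_right _ ((Finset.card_le_card hsub).trans (Finset.card_union_le _ _))
    _ = (n - 2 * M) * (E1.card * (n - 2 * M)) + E2.card * (n - 2 * M) ^ 2 := by ring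
    _ ≤ (n - 2 * M) * Fintype.card (Bool → Equiv.Perm (Fin n)) +
        (2 * M) ^ 4 * Fintype.card (Bool → Equiv.Perm (Fin n)) :=
        Nat.add_le_add (Nat.mul_le_mul_left _ h1') h2'
    _ = _ := by ring

/-- Distinct positive words of the same length have about one collision on average. Common first
letters only move the starting point, and common last letters can be cancelled. -/
theorem card_collision_mul_le {M : ℕ} : ∀ (m : ℕ) (u v : ℕ → Bool), m ≤ M → (∃ i < m, u i ≠ v i) →
    (Finset.univ.filter fun p : (Bool → Equiv.Perm (Fin n)) × Fin n =>
      wordPos p.1 u p.2 m = wordPos p.1 v p.2 m).card * (n - 2 * M) ^ 2 ≤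
        n * (((n - 2 * M) + (2 * M) ^ 4) * Fintype.card (Bool → Equiv.Perm (Fin n))) := by
  intro m
  induction m with
  | zero => rintro u v - ⟨i, hi, -⟩; omega
  | succ m ih =>
    rintro u v hmM ⟨i, hi, hne⟩
    by_cases hlast : u m = v m
    · have him : i < m := by
        refine lt_of_le_of_ne (by omega) ?_
        rintro rfl
        exact hne hlast
      refine le_trans (le_of_eq ?_) (ih u v (by omega) ⟨i, him, hne⟩)
      simp only [wordPos, hlast, EmbeddingLike.apply_eq_iff_eq]
    by_cases hfirst : u 0 = v 0
    · obtain ⟨k, rfl⟩ : ∃ k, i = k + 1 :=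
        Nat.exists_eq_succ_of_ne_zero (by rintro rfl; exact hne hfirst)
      refine le_trans (Nat.mul_le_mul_right _ ?_)
        (ih (fun j => u (j + 1)) (fun j => v (j + 1)) (by omega) ⟨k, by omega, hne⟩)
      refine Finset.card_le_card_of_injOn (fun p => (p.1, p.1 (u 0) p.2)) ?_ ?_
      · intro p hp
        simp only [Finset.coe_filter, Finset.mem_univ, true_and, Set.mem_ofPred_eq] at hp ⊢
        rwa [wordPos_succ_eq, wordPos_succ_eq, ← hfirst] at hp
      · rintro ⟨σ, x⟩ - ⟨σ', x'⟩ - h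
        simp only [Prod.mk.injEq] at h
        obtain ⟨rfl, h⟩ := h
        rw [(σ (u 0)).injective h]
    · have hcore : ∀ x : Fin n, _ := fun x =>
        card_collision_mul_le_of_ne (m := m + 1) (u := u) (v := v) (Nat.succ_pos m) hmM hfirst
          hlast x
      have hcard : (Finset.univ.filter fun p : (Bool → Equiv.Perm (Fin n)) × Fin n =>
          wordPos p.1 u p.2 (m + 1) = wordPos p.1 v p.2 (m + 1)).card =
          ∑ x : Fin n, (Finset.univ.filter fun σ : Bool → Equiv.Perm (Fin n) =>
            wordPos σ u x (m + 1) = wordPos σ v x (m + 1)).card := by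
        simp only [Finset.card_filter, Fintype.sum_prod_type_right]
      rw [hcard, Finset.sum_mul]
      refine (Finset.sum_le_sum fun x _ => hcore x).trans (le_of_eq ?_)
      simp

end Collision

/-! ### Transitivity -/

/-- If the maps `φ i` preserve a nonempty set `S`, two of them chosen at random agree on at least
one point of `S` on average: by the Cauchy–Schwarz inequality, for each `x ∈ S` they agree at `x`
with probability at least `1 / |S|`. -/
theorem sq_card_le_sum_card_agree {ι X : Type*} [Fintype ι] [DecidableEq X] {S : Finset X}
    (hS : S.Nonempty) {φ : ι → X → X} (hφ : ∀ i, ∀ x ∈ S, φ i x ∈ S) :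
    Fintype.card ι ^ 2 ≤ ∑ p : ι × ι, (S.filter fun x => φ p.1 x = φ p.2 x).card := by
  classical
  have hx : ∀ x ∈ S, Fintype.card ι ^ 2 ≤
      S.card * (Finset.univ.filter fun p : ι × ι => φ p.1 x = φ p.2 x).card := by
    intro x hx
    have e1 : Fintype.card ι = ∑ y ∈ S, (Finset.univ.filter fun i => φ i x = y).card := by
      rw [← Finset.card_univ]
      exact Finset.card_eq_sum_card_fiberwise fun i _ => hφ i x hx
    have e2 : (Finset.univ.filter fun p : ι × ι => φ p.1 x = φ p.2 x).card =
        ∑ y ∈ S, (Finset.univ.filter fun i => φ i x = y).card ^ 2 := by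
      rw [Finset.card_eq_sum_card_fiberwise (f := fun p : ι × ι => φ p.1 x) (t := S)
        fun p _ => hφ p.1 x hx]
      refine Finset.sum_congr rfl fun y _ => ?_
      rw [sq, ← Finset.card_product]
      congr 1
      ext p
      simp only [Finset.mem_filter, Finset.mem_univ, true_and, Finset.mem_product]
      constructor
      · rintro ⟨h, rfl⟩; exact ⟨rfl, h.symm⟩
      · rintro ⟨h, h'⟩; exact ⟨h.trans h'.symm, h⟩
    rw [e1, e2]
    exact sq_sum_le_card_mul_sum_sq
  have hsum : ∑ p : ι × ι, (S.filter fun x => φ p.1 x = φ p.2 x).card =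
      ∑ x ∈ S, (Finset.univ.filter fun p : ι × ι => φ p.1 x = φ p.2 x).card := by
    simp only [Finset.card_filter]
    exact Finset.sum_comm
  have h := Finset.sum_le_sum hx
  rw [← Finset.mul_sum, ← hsum, Finset.sum_const, smul_eq_mul] at h
  exact Nat.le_of_mul_le_mul_left h hS.card_pos

/-- The word with letters `u`, extended to an infinite one by an arbitrary letter. -/
def extendWord {m : ℕ} (u : Fin m → Bool) (i : ℕ) : Bool :=
  if h : i < m then u ⟨i, h⟩ else false

theorem exists_extendWord_ne {m : ℕ} {u v : Fin m → Bool} (h : u ≠ v) :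
    ∃ i < m, extendWord u i ≠ extendWord v i := by
  obtain ⟨i, hi⟩ := Function.ne_iff.1 h
  exact ⟨i, i.2, by simpa [extendWord] using hi⟩

theorem wordPos_mem {n : ℕ} {σ : Bool → Equiv.Perm (Fin n)} {S : Finset (Fin n)}
    (hS : ∀ b, ∀ x ∈ S, σ b x ∈ S) (u : ℕ → Bool) {x : Fin n} (hx : x ∈ S) (i : ℕ) :
    wordPos σ u x i ∈ S := by
  induction i with
  | zero => exact hx
  | succ i ih => exact hS _ _ ih

/-- If the words of length `m` have fewer than two collisions on average, then there is no proper
nonempty set invariant under both permutations: such a set and its complement would each contribute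
one collision. -/
theorem eq_univ_of_sum_card_collision_lt {n m : ℕ} {σ : Bool → Equiv.Perm (Fin n)}
    (h : ∑ p : (Fin m → Bool) × (Fin m → Bool), (Finset.univ.filter fun x =>
      wordPos σ (extendWord p.1) x m = wordPos σ (extendWord p.2) x m).card < 2 * (2 ^ m) ^ 2)
    {S : Finset (Fin n)} (hne : S.Nonempty) (hS : ∀ b, ∀ x ∈ S, σ b x ∈ S) :
    S = Finset.univ := by
  by_contra hS'
  have hcne : Sᶜ.Nonempty := by
    rwa [Finset.nonempty_iff_ne_empty, Ne, Finset.compl_eq_empty_iff]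
  have hSc : ∀ b, ∀ x ∈ Sᶜ, σ b x ∈ Sᶜ := by
    intro b x hx
    rw [Finset.mem_compl] at hx ⊢
    intro hbx
    have himg : S.image (σ b) = S :=
      Finset.eq_of_subset_of_card_le (Finset.image_subset_iff.2 (hS b))
        (Finset.card_image_of_injective S (σ b).injective).ge
    rw [← himg, Finset.mem_image] at hbx
    obtain ⟨y, hy, hyx⟩ := hbx
    exact hx ((σ b).injective hyx ▸ hy)
  have h1 := sq_card_le_sum_card_agree (ι := Fin m → Bool) hne
    (φ := fun u x => wordPos σ (extendWord u) x m) fun u x hx => wordPos_mem hS _ hx m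
  have h2 := sq_card_le_sum_card_agree (ι := Fin m → Bool) hcne
    (φ := fun u x => wordPos σ (extendWord u) x m) fun u x hx => wordPos_mem hSc _ hx m
  have hcard : Fintype.card (Fin m → Bool) = 2 ^ m := by simp
  have hsplit : ∀ p : (Fin m → Bool) × (Fin m → Bool), (Finset.univ.filter fun x =>
      wordPos σ (extendWord p.1) x m = wordPos σ (extendWord p.2) x m).card =
      (S.filter fun x =>
        wordPos σ (extendWord p.1) x m = wordPos σ (extendWord p.2) x m).card +
      (Sᶜ.filter fun x =>
        wordPos σ (extendWord p.1) x m = wordPos σ (extendWord p.2) x m).card := by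
    intro p
    rw [← Finset.union_compl S, Finset.filter_union, Finset.card_union_of_disjoint]
    exact Finset.disjoint_filter_filter disjoint_compl_right
  simp only [hsplit, Finset.sum_add_distrib] at h
  rw [hcard] at h1 h2
  omega

/-- Invariance under a generating set suffices to test transitivity. -/
theorem isPretransitive_closure_of_forall {n : ℕ} {T : Set (Equiv.Perm (Fin n))}
    (h : ∀ S : Finset (Fin n), S.Nonempty → (∀ τ ∈ T, ∀ x ∈ S, τ x ∈ S) → S = Finset.univ) :
    MulAction.IsPretransitive (Subgroup.closure T) (Fin n) := by
  classical
  refine ⟨fun x y => ?_⟩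
  let S : Finset (Fin n) := Finset.univ.filter fun z => ∃ g : Subgroup.closure T, g • x = z
  have hS : S = Finset.univ := by
    refine h S ⟨x, by simpa [S] using ⟨1, one_mem _, rfl⟩⟩ fun τ hτ z hz => ?_
    simp only [S, Finset.mem_filter, Finset.mem_univ, true_and] at hz ⊢
    obtain ⟨g, rfl⟩ := hz
    exact ⟨⟨τ, Subgroup.subset_closure hτ⟩ * g, mul_smul _ _ _⟩
  have hy : y ∈ S := hS ▸ Finset.mem_univ y
  simpa [S] using hy

/-- For independent nearly uniform permutations, the expected number of collisions of two random
words of length `m` is less than two, so some pair of permutations in the support of the weight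
generates a transitive group. -/
theorem exists_isPretransitive_of_large {n m : ℕ} (hU : 4 * n ≤ 2 ^ m) (hn : 32 * (2 * m) ^ 4 ≤ n)
    (hn1 : 3 ≤ n) {A : Set (Equiv.Perm (Fin n))} (hinv : A = A⁻¹) (h1 : 1 ∈ A)
    (hA : alternatingGroup (Fin n) ≤ Subgroup.closure A) :
    ∃ j ∈ A ^ (8 * n ^ (6 * m)), ∃ h ∈ A ^ (8 * n ^ (6 * m)),
      MulAction.IsPretransitive
        (Subgroup.closure ({1, j, h} : Set (Equiv.Perm (Fin n)))) (Fin n) := by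
  classical
  have hm : 0 < m := by
    rcases Nat.eq_zero_or_pos m with rfl | h
    · simp at hU; omega
    · exact h
  have hm4 : 8 * (2 * m) ≤ (2 * m) ^ 4 := by
    calc 8 * (2 * m) = 2 ^ 3 * (2 * m) := by ring
      _ ≤ (2 * m) ^ 3 * (2 * m) :=
        Nat.mul_le_mul_right _ (Nat.pow_le_pow_left (by omega) 3)
      _ = _ := by ring
  obtain ⟨μ, hμ0, hμ1, hμA, hμ⟩ := exists_weight_perm (k := 2 * m) (by omega) hinv h1 hA
  have hlen : Fintype.card (Fin (2 * m) ↪ Fin n) * (8 * Fintype.card (Fin (2 * m) ↪ Fin n) ^ 2) ≤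
      8 * n ^ (6 * m) := by
    have hN : Fintype.card (Fin (2 * m) ↪ Fin n) ≤ n ^ (2 * m) := by
      rw [Fintype.card_embedding_eq]
      simpa using Nat.descFactorial_le_pow n (2 * m)
    calc _ ≤ n ^ (2 * m) * (8 * (n ^ (2 * m)) ^ 2) := by gcongr
      _ = 8 * n ^ (6 * m) := by ring
  let Ω := Bool → Equiv.Perm (Fin n)
  set c : (Fin m → Bool) × (Fin m → Bool) → ℕ := fun p =>
    (Finset.univ.filter fun y : Ω × Fin n =>
      wordPos y.1 (extendWord p.1) y.2 m = wordPos y.1 (extendWord p.2) y.2 m).card with hc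
  set F : Ω → ℕ := fun σ => ∑ p : (Fin m → Bool) × (Fin m → Bool), (Finset.univ.filter fun x =>
      wordPos σ (extendWord p.1) x m = wordPos σ (extendWord p.2) x m).card with hF
  have hΩ : (0 : ℝ) < Fintype.card Ω := by exact_mod_cast Fintype.card_pos
  have hnR : (32 : ℝ) * (2 * m) ^ 4 ≤ n := by exact_mod_cast hn
  have hm4R : (8 : ℝ) * (2 * m) ≤ (2 * m) ^ 4 := by exact_mod_cast hm4
  have hn0 : (0 : ℝ) < n := by exact_mod_cast (by omega : 0 < n)
  -- distinct words have at most `5 / 4` collisions on average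
  have hoff : ∀ p : (Fin m → Bool) × (Fin m → Bool), p.1 ≠ p.2 →
      (c p : ℝ) ≤ 5 / 4 * Fintype.card Ω := by
    intro p hp
    have h := card_collision_mul_le (n := n) (M := m) m _ _ le_rfl (exists_extendWord_ne hp)
    have hR : (c p : ℝ) * ((n : ℝ) - 2 * m) ^ 2 ≤
        n * ((((n : ℝ) - 2 * m) + (2 * m) ^ 4) * Fintype.card Ω) := by
      have h' : ((c p * (n - 2 * m) ^ 2 : ℕ) : ℝ) ≤
          ((n * (((n - 2 * m) + (2 * m) ^ 4) * Fintype.card Ω) : ℕ) : ℝ) := by exact_mod_cast h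
      push_cast [Nat.cast_sub (show 2 * m ≤ n by omega)] at h'
      exact h'
    set D : ℝ := (n : ℝ) - 2 * m with hD
    have hD1 : 15 / 16 * (n : ℝ) ≤ D := by linarith
    have hD0 : 0 < D := by linarith
    have hDn : D ≤ n := by
      have : (0 : ℝ) ≤ m := by positivity
      linarith
    have hDn2 : n * (D + (2 * m) ^ 4) ≤ 5 / 4 * D ^ 2 := by nlinarith
    have h3 : (c p : ℝ) * D ^ 2 ≤ 5 / 4 * Fintype.card Ω * D ^ 2 := by
      refine hR.trans ?_
      rw [← mul_assoc]
      have := mul_le_mul_of_nonneg_right hDn2 hΩ.le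
      linarith
    exact le_of_mul_le_mul_right h3 (by positivity)
  have hdiag : ∀ p : (Fin m → Bool) × (Fin m → Bool), (c p : ℝ) ≤ n * Fintype.card Ω := by
    intro p
    have h : c p ≤ Fintype.card (Ω × Fin n) := Finset.card_le_univ _
    rw [Fintype.card_prod, Fintype.card_fin, mul_comm] at h
    exact_mod_cast h
  have hcsum : ∑ p, (c p : ℝ) ≤ 3 / 2 * (2 ^ m) ^ 2 * Fintype.card Ω := by
    have hle : ∀ p : (Fin m → Bool) × (Fin m → Bool), (c p : ℝ) ≤
        5 / 4 * Fintype.card Ω + if p.1 = p.2 then n * (Fintype.card Ω : ℝ) else 0 := by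
      intro p
      split_ifs with h
      · have := hdiag p
        linarith
      · rw [add_zero]
        exact hoff p h
    refine (Finset.sum_le_sum fun p _ => hle p).trans ?_
    rw [Finset.sum_add_distrib, Fintype.sum_prod_type
      (f := fun p : (Fin m → Bool) × (Fin m → Bool) =>
        if p.1 = p.2 then n * (Fintype.card Ω : ℝ) else 0)]
    simp only [Finset.sum_const, Finset.card_univ, Fintype.card_prod, Fintype.card_pi,
      Fintype.card_bool, Finset.prod_const, Fintype.card_fin, nsmul_eq_mul, Finset.sum_ite_eq,
      Finset.mem_univ, if_true]
    have hUR : (4 : ℝ) * n ≤ 2 ^ m := by exact_mod_cast hU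
    have h2 : (0 : ℝ) < 2 ^ m := by positivity
    push_cast
    have : (2 : ℝ) ^ m * (n * Fintype.card Ω) ≤ 2 ^ m * (2 ^ m / 4 * Fintype.card Ω) := by
      gcongr
      linarith
    nlinarith
  have hexp : ∑ σ : Ω, (∏ b, μ (σ b)) * F σ ≤ (9 / 8) ^ 2 * (3 / 2 * (2 ^ m) ^ 2) := by
    have e1 : ∑ σ : Ω, (∏ b, μ (σ b)) * (F σ : ℝ) =
        ∑ p : (Fin m → Bool) × (Fin m → Bool), ∑ x : Fin n, ∑ σ ∈ Finset.univ.filter fun σ : Ω =>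
          wordPos σ (extendWord p.1) x m = wordPos σ (extendWord p.2) x m, ∏ b, μ (σ b) := by
      simp only [hF, Finset.card_filter, Finset.sum_filter]
      push_cast
      simp only [Finset.mul_sum, mul_ite, mul_one, mul_zero]
      rw [Finset.sum_comm]
      exact Finset.sum_congr rfl fun p _ => Finset.sum_comm
    rw [e1]
    have e2 : ∀ p : (Fin m → Bool) × (Fin m → Bool),
        (∑ x : Fin n, ∑ σ ∈ Finset.univ.filter fun σ : Ω =>
          wordPos σ (extendWord p.1) x m = wordPos σ (extendWord p.2) x m, ∏ b, μ (σ b)) ≤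
        (9 / 8) ^ 2 * (c p / Fintype.card Ω) := by
      intro p
      have hcp : (c p : ℝ) = ∑ x : Fin n, ((Finset.univ.filter fun σ : Ω =>
          wordPos σ (extendWord p.1) x m = wordPos σ (extendWord p.2) x m).card : ℝ) := by
        simp only [hc, Finset.card_filter, Fintype.sum_prod_type_right]
        push_cast
        rfl
      rw [hcp, Finset.sum_div, Finset.mul_sum]
      refine Finset.sum_le_sum fun x _ => ?_
      refine sum_prod_weight_le
        (isExploration_collisionQuery m (extendWord p.1) (extendWord p.2) x) hμ0 hμ ?_
      intro σ σ' hσ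
      have hl := determinedBefore_wordPos_left (m := m) (extendWord p.1) (extendWord p.2) x
        (le_refl m) (show m ≤ 2 * m by omega) σ σ' hσ
      have hr := determinedBefore_wordPos_right (m := m) (extendWord p.1) (extendWord p.2) x
        (show m + m ≤ 2 * m by omega) σ σ' hσ
      dsimp only at hl hr ⊢
      rw [hl, hr]
    refine (Finset.sum_le_sum fun p _ => e2 p).trans ?_
    rw [← Finset.mul_sum, ← Finset.sum_div]
    gcongr
    rw [div_le_iff₀ hΩ]
    exact hcsum
  have hW1 : ∑ σ : Ω, ∏ b, μ (σ b) = 1 := by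
    have h := Finset.prod_univ_sum (fun _ : Bool => (Finset.univ : Finset (Equiv.Perm (Fin n))))
      (fun _ τ => μ τ)
    rw [Fintype.piFinset_univ] at h
    rw [← h]
    simp [hμ1]
  obtain ⟨σ, hσW, hσF⟩ : ∃ σ : Ω, (∏ b, μ (σ b)) ≠ 0 ∧ F σ < 2 * (2 ^ m) ^ 2 := by
    by_contra! hcon
    have hge : ∑ σ : Ω, (∏ b, μ (σ b)) * (2 * (2 ^ m) ^ 2) ≤
        ∑ σ : Ω, (∏ b, μ (σ b)) * (F σ : ℝ) := by
      refine Finset.sum_le_sum fun σ _ => ?_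
      by_cases h0 : (∏ b, μ (σ b)) = 0
      · rw [h0, zero_mul, zero_mul]
      · refine mul_le_mul_of_nonneg_left ?_ (Finset.prod_nonneg fun b _ => hμ0 _)
        exact_mod_cast hcon σ h0
    rw [← Finset.sum_mul, hW1, one_mul] at hge
    have h2 : (0 : ℝ) < (2 ^ m) ^ 2 := by positivity
    linarith
  have hmem : ∀ b, σ b ∈ A ^ (8 * n ^ (6 * m)) := fun b =>
    Set.pow_subset_pow_right h1 hlen (hμA _ (Finset.prod_ne_zero_iff.1 hσW b (Finset.mem_univ b)))
  refine ⟨σ true, hmem true, σ false, hmem false, isPretransitive_closure_of_forall ?_⟩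
  intro S hne hS
  refine eq_univ_of_sum_card_collision_lt hσF hne ?_
  rintro (_ | _) x hx
  · exact hS _ (by simp) x hx
  · exact hS _ (by simp) x hx

/-! ### Explicit generators in small degree -/

theorem isPretransitive_closure_of_reachable {n : ℕ} {T : Set (Equiv.Perm (Fin n))} {x : Fin n}
    (h : ∀ y, y ∈ MulAction.orbit (Subgroup.closure T) x) :
    MulAction.IsPretransitive (Subgroup.closure T) (Fin n) :=
  (MulAction.isPretransitive_iff_base x).2 h

theorem apply_mem_orbit_closure {n : ℕ} {T : Set (Equiv.Perm (Fin n))} {x y z : Fin n}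
    {τ : Equiv.Perm (Fin n)} (hτ : τ ∈ T) (hy : y ∈ MulAction.orbit (Subgroup.closure T) x)
    (hz : τ y = z) : z ∈ MulAction.orbit (Subgroup.closure T) x := by
  rw [← hz]
  exact MulAction.mem_orbit_of_mem_orbit (⟨τ, Subgroup.subset_closure hτ⟩ : Subgroup.closure T) hy

theorem isPretransitive_closure_of_finRotate_mem {k : ℕ} {T : Set (Equiv.Perm (Fin (k + 1)))}
    (hT : finRotate (k + 1) ∈ T) :
    MulAction.IsPretransitive (Subgroup.closure T) (Fin (k + 1)) := by
  refine isPretransitive_closure_of_reachable (x := 0) fun y => ?_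
  induction y using Fin.induction with
  | zero => exact MulAction.mem_orbit_self _
  | succ i ih => exact apply_mem_orbit_closure hT ih (by simp)

/-- For odd degree an `n`-cycle is even; for even degree two `(n - 1)`-cycles with different fixed
points serve. -/
theorem exists_alternating_isPretransitive {n : ℕ} (hn : 3 ≤ n) :
    ∃ j ∈ alternatingGroup (Fin n), ∃ h ∈ alternatingGroup (Fin n),
      MulAction.IsPretransitive
        (Subgroup.closure ({1, j, h} : Set (Equiv.Perm (Fin n)))) (Fin n) := by
  rcases Nat.even_or_odd n with heven | hodd
  · obtain ⟨k, rfl⟩ : ∃ k, n = k + 4 := by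
      obtain ⟨r, hr⟩ := heven
      exact ⟨n - 4, by omega⟩
    have h01 : (0 : Fin (k + 4)) ≠ 1 := by simp
    have h02 : (0 : Fin (k + 4)) ≠ 2 := by simp [Fin.ext_iff, Nat.mod_eq_of_lt]
    have h12 : (1 : Fin (k + 4)) ≠ 2 := by simp [Fin.ext_iff, Nat.mod_eq_of_lt]
    have hsign : Equiv.Perm.sign (finRotate (k + 4)) = -1 := by
      rw [sign_finRotate]
      refine Odd.neg_one_pow ?_
      obtain ⟨r, hr⟩ := heven
      exact ⟨r - 1, by omega⟩
    refine ⟨finRotate (k + 4) * Equiv.swap 0 1, ?_, finRotate (k + 4) * Equiv.swap 1 2, ?_, ?_⟩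
    · rw [Equiv.Perm.mem_alternatingGroup, Equiv.Perm.sign_mul, hsign, Equiv.Perm.sign_swap h01]
      decide
    · rw [Equiv.Perm.mem_alternatingGroup, Equiv.Perm.sign_mul, hsign, Equiv.Perm.sign_swap h12]
      decide
    · set T : Set (Equiv.Perm (Fin (k + 4))) :=
        {1, finRotate (k + 4) * Equiv.swap 0 1, finRotate (k + 4) * Equiv.swap 1 2} with hT
      have hj : finRotate (k + 4) * Equiv.swap 0 1 ∈ T := by simp [hT]
      have hh : finRotate (k + 4) * Equiv.swap 1 2 ∈ T := by simp [hT]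
      have hreach : ∀ i (hi : i < k + 4),
          (⟨i, hi⟩ : Fin (k + 4)) ∈ MulAction.orbit (Subgroup.closure T) (0 : Fin (k + 4)) := by
        intro i
        induction i with
        | zero => intro _; exact MulAction.mem_orbit_self _
        | succ i ih =>
          intro hi
          rcases i with _ | _ | i
          · refine apply_mem_orbit_closure hh (MulAction.mem_orbit_self _) ?_
            rw [Equiv.Perm.mul_apply, Equiv.swap_apply_of_ne_of_ne h01 h02]
            simp
          · refine apply_mem_orbit_closure hj (MulAction.mem_orbit_self _) ?_
            rw [Equiv.Perm.mul_apply, Equiv.swap_apply_left, finRotate_of_lt (by simp)]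
            simp
          · refine apply_mem_orbit_closure hj (ih (by omega)) ?_
            rw [Equiv.Perm.mul_apply, Equiv.swap_apply_of_ne_of_ne, finRotate_of_lt (by omega)]
            · simp [Fin.ext_iff]
            · simp [Fin.ext_iff]
      exact isPretransitive_closure_of_reachable fun y => hreach y y.2
  · obtain ⟨k, rfl⟩ : ∃ k, n = k + 1 := ⟨n - 1, by omega⟩
    refine ⟨finRotate (k + 1), ?_, 1, one_mem _,
      isPretransitive_closure_of_finRotate_mem (by simp)⟩
    rw [Equiv.Perm.mem_alternatingGroup, sign_finRotate]
    refine Even.neg_one_pow ?_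
    obtain ⟨r, hr⟩ := hodd
    exact ⟨r, by omega⟩

/-! ### Word length -/

/-- The degrees in which the main argument applies to words of length `Nat.log 2 n + 3`. -/
theorem exists_forall_pow_log_le :
    ∃ n₀ : ℕ, 3 ≤ n₀ ∧ ∀ n ≥ n₀, 32 * (2 * (Nat.log 2 n + 3)) ^ 4 ≤ n := by
  have hpow : ∀ L ≥ 30, 512 * (L + 3) ^ 4 ≤ 2 ^ L := by
    intro L hL
    induction L, hL using Nat.le_induction with
    | base => norm_num
    | succ L hL ih =>
      have h : (L + 1 + 3) ^ 4 ≤ 2 * (L + 3) ^ 4 := by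
        obtain ⟨y, rfl⟩ := Nat.exists_eq_add_of_le hL
        ring_nf
        nlinarith [Nat.zero_le (y ^ 4), Nat.zero_le (y ^ 3), Nat.zero_le (y ^ 2)]
      calc 512 * (L + 1 + 3) ^ 4 ≤ 512 * (2 * (L + 3) ^ 4) := Nat.mul_le_mul_left _ h
        _ = 2 * (512 * (L + 3) ^ 4) := by ring
        _ ≤ 2 * 2 ^ L := Nat.mul_le_mul_left _ ih
        _ = 2 ^ (L + 1) := by ring
  refine ⟨2 ^ 30, by norm_num, fun n hn => ?_⟩
  have hL : 30 ≤ Nat.log 2 n := Nat.le_log_of_pow_le (by norm_num) hn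
  calc 32 * (2 * (Nat.log 2 n + 3)) ^ 4 = 512 * (Nat.log 2 n + 3) ^ 4 := by ring
    _ ≤ 2 ^ Nat.log 2 n := hpow _ hL
    _ ≤ n := Nat.pow_log_le_self 2 (by omega)

theorem pow_le_rpow_mul_log {n : ℕ} (hn : 2 ≤ n) {C : ℝ} (hC : 54 ≤ C) :
    ((8 * n ^ (6 * (Nat.log 2 n + 3)) : ℕ) : ℝ) ≤ (n : ℝ) ^ (C * Real.log n) := by
  have hn2 : (2 : ℝ) ≤ n := by exact_mod_cast hn
  have hlog2 : 1 / 2 < Real.log 2 := by have := Real.log_two_gt_d9; linarith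
  have hlogn : Real.log 2 ≤ Real.log n := Real.log_le_log (by norm_num) hn2
  have hL : (Nat.log 2 n : ℝ) * Real.log 2 ≤ Real.log n := by
    rw [← Real.log_pow]
    refine Real.log_le_log (by positivity) ?_
    exact_mod_cast Nat.pow_log_le_self 2 (by omega)
  calc ((8 * n ^ (6 * (Nat.log 2 n + 3)) : ℕ) : ℝ)
      ≤ (n : ℝ) ^ (6 * (Nat.log 2 n + 3) + 3) := by
        push_cast
        rw [pow_add, mul_comm]
        gcongr
        calc (8 : ℝ) = 2 ^ 3 := by norm_num
          _ ≤ (n : ℝ) ^ 3 := by gcongr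
    _ = (n : ℝ) ^ (((6 * (Nat.log 2 n + 3) + 3 : ℕ)) : ℝ) := (Real.rpow_natCast _ _).symm
    _ ≤ (n : ℝ) ^ (C * Real.log n) := by
        refine Real.rpow_le_rpow_of_exponent_le (by linarith) ?_
        push_cast
        have h0 : (0 : ℝ) ≤ Nat.log 2 n := by positivity
        have h1 : (Nat.log 2 n : ℝ) ≤ 2 * Real.log n := by nlinarith
        nlinarith

theorem natCast_le_rpow_mul_log {n K : ℕ} (hn : 2 ≤ n) {C : ℝ} (hC : 4 * K ≤ C) :
    (K : ℝ) ≤ (n : ℝ) ^ (C * Real.log n) := by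
  have hn2 : (2 : ℝ) ≤ n := by exact_mod_cast hn
  have hlog2 : 1 / 2 < Real.log 2 := by have := Real.log_two_gt_d9; linarith
  have hlogn : Real.log 2 ≤ Real.log n := Real.log_le_log (by norm_num) hn2
  have hK : (0 : ℝ) ≤ K := by positivity
  rw [Real.rpow_def_of_pos (by linarith)]
  have h1 : (K : ℝ) ≤ Real.log n * (C * Real.log n) := by
    have hsq : 1 / 4 ≤ Real.log n * Real.log n := by nlinarith
    calc (K : ℝ) ≤ C * (1 / 4) := by linarith
      _ ≤ C * (Real.log n * Real.log n) := by gcongr; linarith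
      _ = _ := by ring
  linarith [Real.add_one_le_exp (Real.log n * (C * Real.log n))]

theorem proposition5p8 :
    ∃ C : ℝ, 0 < C ∧
      ∀ (n : ℕ) (_hn : 1 ≤ n) (A : Set (Equiv.Perm (Fin n))),
        A = A⁻¹ →
        1 ∈ A →
        (Subgroup.closure A = ⊤ ∨ Subgroup.closure A = alternatingGroup (Fin n)) →
        ¬ (n = 2 ∧ Subgroup.closure A = alternatingGroup (Fin n)) →
        ∃ g j h : Equiv.Perm (Fin n),
          g ∈ A ^ n ∧
          (∃ l : ℕ, (l : ℝ) ≤ (n : ℝ) ^ (C * Real.log n) ∧ j ∈ A ^ l ∧ h ∈ A ^ l) ∧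
          MulAction.IsPretransitive
            (Subgroup.closure ({g, j, h} : Set (Equiv.Perm (Fin n)))) (Fin n) := by
  obtain ⟨n₀, hn₀3, hn₀⟩ := exists_forall_pow_log_le
  refine ⟨54 + 4 * (n₀.factorial : ℝ), by positivity, ?_⟩
  intro n hn A hinv h1 hA hn2
  have hfact : (0 : ℝ) ≤ (n₀.factorial : ℝ) := by positivity
  have hAalt : alternatingGroup (Fin n) ≤ Subgroup.closure A := by
    rcases hA with h | h
    · rw [h]; exact le_top
    · rw [h]
  refine ⟨1, ?_⟩
  simp only [Set.one_mem_pow h1, true_and]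
  by_cases hn1 : n = 1
  · subst hn1
    refine ⟨1, 1, ⟨0, by simp, by simp, by simp⟩, ?_⟩
    exact ⟨fun x y => ⟨1, Subsingleton.elim _ _⟩⟩
  by_cases hlarge : n₀ ≤ n
  · obtain ⟨j, hj, h, hh, ht⟩ := exists_isPretransitive_of_large (m := Nat.log 2 n + 3)
      (by
        have := Nat.lt_pow_succ_log_self (b := 2) (by norm_num) n
        rw [pow_succ] at this ⊢
        rw [pow_succ, pow_succ]
        omega)
      (hn₀ n hlarge) (hn₀3.trans hlarge) hinv h1 hAalt
    exact ⟨j, h, ⟨_, pow_le_rpow_mul_log (by omega) (by linarith), hj, hh⟩, ht⟩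
  · -- in bounded degree the length of words is at most the order of the symmetric group
    have hsmall : ∃ j ∈ Subgroup.closure A, ∃ h ∈ Subgroup.closure A,
        MulAction.IsPretransitive
          (Subgroup.closure ({1, j, h} : Set (Equiv.Perm (Fin n)))) (Fin n) := by
      by_cases h2 : n = 2
      · subst h2
        have htop : Subgroup.closure A = ⊤ := hA.resolve_right fun h => hn2 ⟨rfl, h⟩
        exact ⟨finRotate 2, by simp [htop], 1, one_mem _,
          isPretransitive_closure_of_finRotate_mem (by simp)⟩
      · obtain ⟨j, hj, h, hh, ht⟩ := exists_alternating_isPretransitive (n := n) (by omega)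
        exact ⟨j, hAalt hj, h, hAalt hh, ht⟩
    obtain ⟨j, hj, h, hh, ht⟩ := hsmall
    have hcard : Fintype.card (Equiv.Perm (Fin n)) ≤ n₀.factorial := by
      rw [Fintype.card_perm, Fintype.card_fin]
      exact Nat.factorial_le (by omega)
    exact ⟨j, h, ⟨n₀.factorial, natCast_le_rpow_mul_log (by omega) (by linarith),
      Set.pow_subset_pow_right h1 hcard (mem_pow_card_of_mem_closure hinv h1 hj),
      Set.pow_subset_pow_right h1 hcard (mem_pow_card_of_mem_closure hinv h1 hh)⟩, ht⟩
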